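/- Let $\Gamma$ be the unit circle $S^1$ or a cyclic group $\{e^{2\pi i j/k} : 1\le j\le k\}$, $k\ge 1$. Let $G=(V,E)$ be a finite nonempty simple graph on $N$ vertices with positive symmetric edge weights $w_{uv}$, a vertex measure $\mu:V\to(0,\infty)$, and a signature $\sigma$ assigning to each oriented edge $(u,v)$ an element $\sigma_{uv}\in\Gamma$ with $\sigma_{vu}=\sigma_{uv}^{-1}$. Put $d_\mu=\max_{u}\frac1{\mu(u)}\sum_{v\sim u}w_{uv}$, $\mathrm{vol}_\mu(X)=\sum_{u\in X}\mu(u)$, $\mathrm{vol}_\mu(G)=\mathrm{vol}_\mu(V)$, and for nonempty $X\subseteq V$ $$|E(X,X^c)|=\sum_{u\in X,\,v\in X^c,\,u\sim v}w_{uv},\qquad \iota^\sigma(X)=\min_{\tau:X\to\Gamma}\ \sum_{\{u,v\}\in E,\ u,v\in X}w_{uv}\,|\tau(u)-\sigma_{uv}\tau(v)|.$$ Say that $(G,\sigma)$ has isoperimetric dimension $\delta$ with constant $c_\delta>0$ if $\iota^\sigma(X)+|E(X,X^c)|\ge c_\delta\,\mathrm{vol}_\mu(X)^{(\delta-1)/\delta}$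 for every nonempty $X\subseteq V$. Let $\Delta_\sigma$ be the magnetic Laplacian on functions $f:V\to\mathbb C$, $$\Delta_\sigma f(u)=\frac1{\sqrt{\mu(u)}}\sum_{v\sim u}w_{uv}\Big(\frac{f(u)}{\sqrt{\mu(u)}}-\sigma_{uv}\frac{f(v)}{\sqrt{\mu(v)}}\Big),$$ which is Hermitian, let $\lambda_1,\dots,\lambda_N$ be its eigenvalues with multiplicity, and let $K^\sigma_t=e^{-t\Delta_\sigma}$ be its heat kernel, viewed as a $V\times V$ matrix. Theorem. Suppose that $(G,\sigma)$ has isoperimetric dimension $\delta>2$ with constant $c_\delta$. Then there is a constant $C_\delta$ depending only on $\delta$, $c_\delta$ and $d_\mu$ such that for every $t>0$ $$\sum_{j=1}^N e^{-\lambda_j t}\le C_\delta\,\frac{\mathrm{vol}_\mu(G)}{t^{\delta/2}},$$ and, for every $u\in V$, the diagonal entry $K^\sigma_t(u,u)$ is real and satisfies $$K^\sigma_t(u,u)\le C_\delta\,\frac{\mu(u)}{t^{\delta/2}}.$$ -/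

import Mathlib

/-- The signature groups: the unit circle, or a cyclic group generated by `e^{2πi/k}`, `k ≥ 1`. -/
def IsSignatureGroup (Γ : Subgroup Circle) : Prop :=
  Γ = ⊤ ∨ ∃ k : ℕ, 0 < k ∧ Γ = Subgroup.zpowers (Circle.exp (2 * Real.pi / k))

/-- A simple graph with positive symmetric edge weights `w`, a positive vertex measure `μ` and a
`Γ`-valued signature `σ` on oriented edges, `σ (v, u) = σ (u, v)⁻¹`. The values of `w` and `σ` at
pairs of non-adjacent vertices are never used. -/
structure MagneticGraph (V : Type*) (Γ : Subgroup Circle) where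
  graph : SimpleGraph V
  w : V → V → ℝ
  w_symm : ∀ u v, graph.Adj u v → w u v = w v u
  w_pos : ∀ u v, graph.Adj u v → 0 < w u v
  μ : V → ℝ
  μ_pos : ∀ u, 0 < μ u
  σ : V → V → Γ
  σ_inv : ∀ u v, graph.Adj u v → σ v u = (σ u v)⁻¹

namespace MagneticGraph

variable {V : Type*} {Γ : Subgroup Circle}

open Classical in
/-- Weighted degree `d_u`. -/
noncomputable def degree [Fintype V] (G : MagneticGraph V Γ) (u : V) : ℝ :=
  ∑ v with G.graph.Adj u v, G.w u v

/-- Maximal `μ`-degree `d_μ = max_u d_u / μ(u)`. -/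
noncomputable def maxDegree [Fintype V] [Nonempty V] (G : MagneticGraph V Γ) : ℝ :=
  Finset.univ.sup' Finset.univ_nonempty fun u => G.degree u / G.μ u

/-- `μ`-volume of a set of vertices. -/
def vol (G : MagneticGraph V Γ) (X : Finset V) : ℝ := ∑ u ∈ X, G.μ u

open Classical in
/-- Boundary measure `|E(X, Xᶜ)|`. -/
noncomputable def boundary [Fintype V] (G : MagneticGraph V Γ) (X : Finset V) : ℝ :=
  ∑ u ∈ X, ∑ v ∈ Xᶜ with G.graph.Adj u v, G.w u v

open Classical in
/-- `∑_{{u,v} ∈ E(X)} w_{uv} |τ(u) - σ_{uv} τ(v)|`, the sum over the edges of the subgraph induced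
by `X`. The summand does not depend on the orientation of the edge, so the sum over unordered pairs
is half the sum over ordered pairs. -/
noncomputable def frustration (G : MagneticGraph V Γ) (X : Finset V) (τ : X → Γ) : ℝ :=
  (1 / 2) * ∑ u : ↥X, ∑ v ∈ Finset.univ.filter (fun v : ↥X => G.graph.Adj u v),
    G.w u v * ‖((τ u : Circle) : ℂ) - ((G.σ u v : Circle) : ℂ) * ((τ v : Circle) : ℂ)‖

/-- Frustration index: the minimum of `frustration` over all `τ : X → Γ`. (The infimum of a
nonempty set of nonnegative reals; it is attained since `Γ` is compact: the circle or finite.) -/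
noncomputable def frustrationIndex (G : MagneticGraph V Γ) (X : Finset V) : ℝ :=
  ⨅ τ : X → Γ, G.frustration X τ

/-- Isoperimetric dimension `δ` with (positive) isoperimetric constant `c`. -/
def HasIsoperimetricDimension [Fintype V] (G : MagneticGraph V Γ) (δ c : ℝ) : Prop :=
  0 < c ∧ ∀ X : Finset V, X.Nonempty →
    c * G.vol X ^ ((δ - 1) / δ) ≤ G.frustrationIndex X + G.boundary X

open Classical in
/-- The magnetic Laplacian as an operator on functions `V → ℂ`. -/
noncomputable def laplacian [Fintype V] (G : MagneticGraph V Γ) : (V → ℂ) →ₗ[ℂ] (V → ℂ) where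
  toFun f u := 1 / (√(G.μ u) : ℂ) * ∑ v with G.graph.Adj u v,
    (G.w u v : ℂ) * (f u / (√(G.μ u) : ℂ) - ((G.σ u v : Circle) : ℂ) * (f v / (√(G.μ v) : ℂ)))
  map_add' f g := by
    funext u
    simp only [Pi.add_apply, ← mul_add, ← Finset.sum_add_distrib]
    congr 1
    exact Finset.sum_congr rfl fun v _ => by ring
  map_smul' a f := by
    funext u
    simp only [Pi.smul_apply, smul_eq_mul, RingHom.id_apply]
    rw [mul_left_comm a, Finset.mul_sum _ _ a]
    congr 1
    exact Finset.sum_congr rfl fun v _ => by ring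

/-- The matrix of the magnetic Laplacian in the standard basis. -/
noncomputable def laplacianMatrix [Fintype V] [DecidableEq V] (G : MagneticGraph V Γ) :
    Matrix V V ℂ :=
  LinearMap.toMatrix' G.laplacian

theorem laplacianMatrix_isHermitian [Fintype V] [DecidableEq V] (G : MagneticGraph V Γ) :
    G.laplacianMatrix.IsHermitian := by
  classical
  ext u v
  rw [Matrix.conjTranspose_apply]
  simp only [laplacianMatrix, LinearMap.toMatrix'_apply, laplacian, LinearMap.coe_mk,
    AddHom.coe_mk]
  by_cases huv : u = v
  · subst huv
    simp only [star_mul', star_sum, star_div₀, star_sub, star_one, RCLike.star_def,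
      Complex.conj_ofReal]
    congr 1
    refine Finset.sum_congr rfl fun v hv => ?_
    have hne : v ≠ u := fun h => by simp [h] at hv
    simp [hne]
  · have key : ∀ a b : V, a ≠ b →
        (∑ x with G.graph.Adj a x, (G.w a x : ℂ) *
          ((Pi.single b (1 : ℂ) : V → ℂ) a / (√(G.μ a) : ℂ) - ((G.σ a x : Circle) : ℂ) *
            ((Pi.single b (1 : ℂ) : V → ℂ) x / (√(G.μ x) : ℂ)))) =
        if G.graph.Adj a b then -((G.w a b : ℂ) * (((G.σ a b : Circle) : ℂ) / (√(G.μ b) : ℂ)))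
          else 0 := by
      intro a b hab
      rw [Finset.sum_filter, Finset.sum_eq_single b]
      · simp [hab, div_eq_mul_inv]
      · intro x _ hx
        simp [hab, hx]
      · simp
    rw [key v u (Ne.symm huv), key u v huv]
    by_cases h : G.graph.Adj u v
    · have hs : ((G.σ v u : Circle) : ℂ) = star ((G.σ u v : Circle) : ℂ) := by
        rw [G.σ_inv u v h, Subgroup.coe_inv, Circle.coe_inv_eq_conj]
        rfl
      simp only [h, h.symm, if_true, G.w_symm u v h, hs, star_mul', star_neg, star_div₀, star_one,
        RCLike.star_def, Complex.conj_ofReal, Complex.conj_conj]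
      ring
    · have h' : ¬ G.graph.Adj v u := fun h' => h h'.symm
      simp [h, h']

/-- The eigenvalues of the magnetic Laplacian, with multiplicity. -/
noncomputable def eigenvalue [Fintype V] [DecidableEq V] (G : MagneticGraph V Γ) : V → ℝ :=
  G.laplacianMatrix_isHermitian.eigenvalues

/-- The heat kernel `e^{-tΔ}`. -/
noncomputable def heatKernel [Fintype V] [DecidableEq V] (G : MagneticGraph V Γ) (t : ℝ) :
    Matrix V V ℂ :=
  NormedSpace.exp (-(t : ℂ) • G.laplacianMatrix)

end MagneticGraph

/-! The proof runs from isoperimetry to a Nash inequality, and from there to heat kernel decay. The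
signature enters only through phases.

Write `g u = ‖g u‖ * z u` with `z u` on the circle. The frustration index is a minimum over
`Γ`-valued potentials, while `z` is circle-valued. When `Γ` is cyclic, arguments are rounded to a
randomly shifted grid; floors are unbiased on average, so only the arc-to-chord factor `π/2` is lost
(`exists_rounding`, `frustrationIndex_le`). Isoperimetry on the superlevel sets of `‖g‖ ^ 2`,
integrated over levels above `r ^ 2`, and Markov's inequality for their volume give
`truncated_sobolev`. With `N = ∑ μ‖g‖²` and `M = ∑ μ‖g‖`, the choice `r = N / (2M)` and
Cauchy–Schwarz yield `nash`: `c² N (N / (2M²)) ^ (2/δ) ≤ 32 d_μ E(g)`.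

Apply `nash` to the column at `u` of the heat kernel at time `t/2`, divided by `√μ`. Then `N =
K_t(u,u)`, the energy is `-d/dt K_t(u,u)`, and `M² ≤ μ(u)` because the magnetic semigroup is
dominated by the unsigned one (`heatKernel_l1_bound`). The resulting inequality `-k' ≥ a k ^ (1 +
2/δ)` integrates to the diagonal bound; summing over `u` bounds the trace. -/

/-! ### Random rounding of the circle to a signature group -/

theorem integral_floor_add (a : ℝ) : ∫ θ in (0 : ℝ)..1, (⌊a + θ⌋ : ℝ) = a := by
  have hper : Function.Periodic (Int.fract : ℝ → ℝ) 1 := fun x => Int.fract_add_one x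
  have hfr : ∫ x in a..a + 1, Int.fract x = 1 / 2 := by
    rw [hper.intervalIntegral_add_eq a 0, zero_add]
    have h : ∫ x in (0 : ℝ)..1, Int.fract x = ∫ x in (0 : ℝ)..1, x := by
      refine intervalIntegral.integral_congr_ae ?_
      have h1 : ∀ᵐ x : ℝ, x ≠ 1 := by simp [MeasureTheory.ae_iff]
      filter_upwards [h1] with x hx hx'
      rw [Set.uIoc_of_le zero_le_one] at hx'
      exact Int.fract_eq_self.2 ⟨hx'.1.le, lt_of_le_of_ne hx'.2 hx⟩
    rw [h]; simp
  have hmono : Monotone fun x : ℝ => (⌊x⌋ : ℝ) := fun x y h =>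
    Int.cast_le.2 (Int.floor_mono h)
  have hint : ∫ x in a..a + 1, (⌊x⌋ : ℝ) = a := by
    have h1 : ∫ x in a..a + 1, Int.fract x = ∫ x in a..a + 1, (x - (⌊x⌋ : ℝ)) := rfl
    rw [intervalIntegral.integral_sub intervalIntegral.intervalIntegrable_id
      hmono.intervalIntegrable, hfr, integral_id] at h1
    linarith
  rw [intervalIntegral.integral_comp_add_left (fun x => (⌊x⌋ : ℝ)) a, add_zero, hint]

theorem intervalIntegrable_floor_add (a : ℝ) :
    IntervalIntegrable (fun θ : ℝ => (⌊a + θ⌋ : ℝ)) MeasureTheory.volume 0 1 := by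
  refine Monotone.intervalIntegrable fun x y h => ?_
  exact_mod_cast Int.floor_mono (by linarith)

/-- Monotonicity of the floor removes the absolute value, so unbiasedness of the shifted floor makes
rounding preserve distances exactly on average. -/
theorem integral_abs_floor_sub_floor (a b : ℝ) :
    ∫ θ in (0 : ℝ)..1, |(⌊a + θ⌋ : ℝ) - ⌊b + θ⌋| = |a - b| := by
  wlog h : b ≤ a generalizing a b
  · rw [abs_sub_comm, ← this b a (le_of_not_ge h)]
    exact intervalIntegral.integral_congr fun θ _ => abs_sub_comm _ _
  have : ∀ θ : ℝ, |(⌊a + θ⌋ : ℝ) - ⌊b + θ⌋| = (⌊a + θ⌋ : ℝ) - ⌊b + θ⌋ := fun θ => by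
    refine abs_of_nonneg (sub_nonneg.2 ?_)
    exact_mod_cast Int.floor_mono (by linarith)
  simp_rw [this]
  rw [intervalIntegral.integral_sub (intervalIntegrable_floor_add a)
    (intervalIntegrable_floor_add b), integral_floor_add, integral_floor_add,
    abs_of_nonneg (by linarith)]

theorem Circle.norm_exp_sub_exp_le (x y : ℝ) :
    ‖(Circle.exp x : ℂ) - Circle.exp y‖ ≤ |x - y| := by
  have h : (Circle.exp x : ℂ) - Circle.exp y =
      Circle.exp y * (Complex.exp (Complex.I * ((x - y : ℝ) : ℂ)) - 1) := by
    rw [mul_sub, mul_one, Circle.coe_exp, Circle.coe_exp, ← Complex.exp_add]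
    push_cast
    ring_nf
  rw [h, norm_mul, Circle.norm_coe, one_mul]
  simpa using Real.norm_exp_I_mul_ofReal_sub_one_le (x := x - y)

/-- An arc is at most `π/2` times its chord; this is the only loss in the rounding. -/
theorem Circle.exists_exp_mul_eq (z z' : Circle) :
    ∃ α : ℝ, z = z' * Circle.exp α ∧ |α| ≤ Real.pi / 2 * ‖(z : ℂ) - z'‖ := by
  refine ⟨Complex.arg (z / z' : Circle), ?_, ?_⟩
  · rw [Circle.exp_arg, mul_div_cancel]
  · have h := Complex.angle_le_mul_norm_sub (x := (z : ℂ)) (y := z')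
      (Circle.norm_coe z) (Circle.norm_coe z')
    rwa [Complex.angle_eq_abs_arg (Circle.coe_ne_zero z) (Circle.coe_ne_zero z'),
      ← Circle.coe_div] at h

/-- Randomized equivariant rounding of the circle to a signature group. -/
theorem IsSignatureGroup.exists_rounding {Γ : Subgroup Circle} (hΓ : IsSignatureGroup Γ) :
    ∃ R : ℝ → Circle → Γ, ∀ (z z' : Circle) (σ : Γ), ∃ b : ℝ → ℝ,
      IntervalIntegrable b MeasureTheory.volume 0 1 ∧
      (∀ θ, ‖((R θ z : Circle) : ℂ) - ((σ : Circle) : ℂ) * ((R θ z' : Circle) : ℂ)‖ ≤ b θ) ∧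
      ∫ θ in (0 : ℝ)..1, b θ ≤ Real.pi / 2 * ‖(z : ℂ) - ((σ : Circle) : ℂ) * z'‖ := by
  obtain rfl | ⟨k, hk, rfl⟩ := hΓ
  · refine ⟨fun _ z => ⟨z, trivial⟩, fun z z' σ =>
      ⟨fun _ => ‖(z : ℂ) - ((σ : Circle) : ℂ) * z'‖, by simp, fun _ => le_rfl, ?_⟩⟩
    have : 1 ≤ Real.pi / 2 := by linarith [Real.two_le_pi]
    simpa using le_mul_of_one_le_left (norm_nonneg _) this
  · have hk0 : (0 : ℝ) < k := by exact_mod_cast hk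
    have hpi := Real.pi_pos
    set ω : ℝ := 2 * Real.pi / k with hω
    have hω0 : 0 < ω := by positivity
    have hωk : k * ω = 2 * Real.pi := by rw [hω]; field_simp
    -- The argument is rounded down to the grid of step `ω`, after a shift by the fraction `θ` of a
    -- step.
    refine ⟨fun θ z => ⟨Circle.exp ω ^ ⌊Complex.arg z / ω + θ⌋, Subgroup.zpow_mem_zpowers _ _⟩,
      fun z z' σ => ?_⟩
    obtain ⟨α, hα, hαle⟩ := Circle.exists_exp_mul_eq z (σ * z')
    obtain ⟨m, hm⟩ := Subgroup.mem_zpowers_iff.1 σ.2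
    -- Arguments add only modulo `2π = k * ω`. That ambiguity is `n * k` whole grid steps, which the
    -- floor passes through and `Circle.exp ω` sends to `1`; multiplication by `σ` is likewise a
    -- shift by `m` steps.
    obtain ⟨n, hn⟩ : ∃ n : ℤ,
        Complex.arg z = (m * ω + Complex.arg z' + α) + n * (2 * Real.pi) := by
      rw [← Circle.exp_eq_exp, Circle.exp_add, Circle.exp_add, Circle.exp_intCast_mul,
        Circle.exp_arg, Circle.exp_arg, hm, ← hα]
    set y := Complex.arg z' / ω with hy
    have hz : Complex.arg z / ω = (y + α / ω) + ((m + n * k : ℤ) : ℝ) := by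
      rw [hn, ← hωk, hy]
      push_cast
      field_simp
      ring
    refine ⟨fun θ => ω * |(⌊(y + α / ω) + θ⌋ : ℝ) - ⌊y + θ⌋|, ?_, fun θ => ?_, ?_⟩
    · exact (((intervalIntegrable_floor_add _).sub (intervalIntegrable_floor_add _)).abs).const_mul _
    · have h1 : Circle.exp ω ^ ⌊Complex.arg z / ω + θ⌋ =
          σ * Circle.exp (⌊(y + α / ω) + θ⌋ * ω) := by
        have : ⌊Complex.arg z / ω + θ⌋ = ⌊(y + α / ω) + θ⌋ + (m + n * k) := by
          rw [hz, ← Int.floor_add_intCast]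
          congr 1
          ring
        rw [this, zpow_add, zpow_add, hm, ← Circle.exp_intCast_mul ω (n * k)]
        have h2 : Circle.exp (((n * k : ℤ) : ℝ) * ω) = 1 := by
          rw [show ((n * k : ℤ) : ℝ) * ω = n * (2 * Real.pi) by rw [← hωk]; push_cast; ring]
          exact Circle.exp_int_mul_two_pi n
        rw [h2, mul_one, mul_comm, Circle.exp_intCast_mul]
      change ‖((Circle.exp ω ^ ⌊Complex.arg z / ω + θ⌋ : Circle) : ℂ) -
        ((σ : Circle) : ℂ) * ((Circle.exp ω ^ ⌊y + θ⌋ : Circle) : ℂ)‖ ≤ _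
      rw [h1, ← Circle.exp_intCast_mul, Circle.coe_mul, ← mul_sub, norm_mul, Circle.norm_coe,
        one_mul]
      refine (Circle.norm_exp_sub_exp_le _ _).trans_eq ?_
      rw [← sub_mul, abs_mul, abs_of_pos hω0, mul_comm]
    · rw [intervalIntegral.integral_const_mul, integral_abs_floor_sub_floor, add_sub_cancel_left,
        abs_div, abs_of_pos hω0, mul_div_cancel₀ _ hω0.ne']
      simpa using hαle

/-! ### Edge weights and circle-valued potentials -/

namespace MagneticGraph

variable {V : Type*} {Γ : Subgroup Circle}

open Classical in
/-- The edge weights, extended by zero to non-adjacent pairs. -/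
noncomputable def weight (G : MagneticGraph V Γ) (u v : V) : ℝ :=
  if G.graph.Adj u v then G.w u v else 0

theorem weight_nonneg (G : MagneticGraph V Γ) (u v : V) : 0 ≤ G.weight u v := by
  unfold weight
  split_ifs with h
  exacts [(G.w_pos u v h).le, le_rfl]

theorem weight_symm (G : MagneticGraph V Γ) (u v : V) : G.weight u v = G.weight v u := by
  unfold weight
  by_cases h : G.graph.Adj u v
  · rw [if_pos h, if_pos h.symm, G.w_symm u v h]
  · rw [if_neg h, if_neg fun h' => h h'.symm]

theorem weight_self (G : MagneticGraph V Γ) (u : V) : G.weight u u = 0 := by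
  simp [weight]

theorem boundary_eq [Fintype V] [DecidableEq V] (G : MagneticGraph V Γ) (X : Finset V) :
    G.boundary X = ∑ u ∈ X, ∑ v ∈ Xᶜ, G.weight u v := by
  classical
  unfold boundary weight
  refine Finset.sum_congr rfl fun u _ => ?_
  rw [Finset.sum_filter]
  exact Finset.sum_congr (by congr!) fun _ _ => rfl

theorem degree_eq [Fintype V] (G : MagneticGraph V Γ) (u : V) :
    G.degree u = ∑ v, G.weight u v := by
  unfold degree weight
  rw [Finset.sum_filter]

theorem frustration_eq (G : MagneticGraph V Γ) (X : Finset V) (τ : V → Γ) :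
    G.frustration X (fun u => τ u) = (1 / 2) * ∑ u ∈ X, ∑ v ∈ X, G.weight u v *
      ‖((τ u : Circle) : ℂ) - ((G.σ u v : Circle) : ℂ) * ((τ v : Circle) : ℂ)‖ := by
  classical
  unfold frustration weight
  rw [← Finset.sum_coe_sort X]
  congr 1
  refine Finset.sum_congr rfl fun u _ => ?_
  simp only [Finset.sum_filter]
  rw [← Finset.sum_coe_sort X]
  refine Finset.sum_congr rfl fun v _ => ?_
  split_ifs <;> simp

theorem frustrationIndex_le_frustration (G : MagneticGraph V Γ) (X : Finset V) (τ : X → Γ) :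
    G.frustrationIndex X ≤ G.frustration X τ := by
  classical
  refine ciInf_le ⟨0, ?_⟩ τ
  rintro _ ⟨τ, rfl⟩
  refine mul_nonneg (by norm_num) (Finset.sum_nonneg fun u _ => Finset.sum_nonneg fun v hv => ?_)
  exact mul_nonneg (G.w_pos _ _ (Finset.mem_filter.1 hv).2).le (norm_nonneg _)

/-- The frustration index is controlled by circle-valued potentials. -/
theorem frustrationIndex_le (hΓ : IsSignatureGroup Γ) (G : MagneticGraph V Γ) (X : Finset V)
    (z : V → Circle) :
    G.frustrationIndex X ≤ Real.pi / 2 * ((1 / 2) * ∑ u ∈ X, ∑ v ∈ X, G.weight u v *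
      ‖(z u : ℂ) - ((G.σ u v : Circle) : ℂ) * z v‖) := by
  obtain ⟨R, hR⟩ := hΓ.exists_rounding
  choose b hb hRb hbi using hR
  -- Every shift gives an admissible `Γ`-valued competitor, so the index is also below the average
  -- over `θ`.
  have hle : ∀ θ : ℝ, G.frustrationIndex X ≤
      (1 / 2) * ∑ u ∈ X, ∑ v ∈ X, G.weight u v * b (z u) (z v) (G.σ u v) θ := fun θ => by
    refine (G.frustrationIndex_le_frustration X (fun u => R θ (z u))).trans ?_
    rw [G.frustration_eq X (fun u => R θ (z u))]
    gcongr with u _ v _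
    · exact G.weight_nonneg u v
    · exact hRb _ _ _ _
  have hint : ∀ u v, IntervalIntegrable (fun θ => G.weight u v * b (z u) (z v) (G.σ u v) θ)
      MeasureTheory.volume 0 1 := fun u v => (hb _ _ _).const_mul _
  have hint' : ∀ u, IntervalIntegrable
      (fun θ => ∑ v ∈ X, G.weight u v * b (z u) (z v) (G.σ u v) θ)
      MeasureTheory.volume 0 1 := fun u => by
    have h := IntervalIntegrable.sum X fun v _ => hint u v
    rwa [Finset.sum_fn] at h
  have hint'' : IntervalIntegrable
      (fun θ => (1 / 2) * ∑ u ∈ X, ∑ v ∈ X, G.weight u v * b (z u) (z v) (G.σ u v) θ)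
      MeasureTheory.volume 0 1 := by
    refine IntervalIntegrable.const_mul ?_ _
    have h := IntervalIntegrable.sum X fun u _ => hint' u
    rwa [Finset.sum_fn] at h
  calc G.frustrationIndex X = ∫ _ in (0 : ℝ)..1, G.frustrationIndex X := by simp
    _ ≤ ∫ θ in (0 : ℝ)..1,
          (1 / 2) * ∑ u ∈ X, ∑ v ∈ X, G.weight u v * b (z u) (z v) (G.σ u v) θ :=
        intervalIntegral.integral_mono_on zero_le_one (by simp) hint'' fun θ _ => hle θ
    _ = (1 / 2) * ∑ u ∈ X, ∑ v ∈ X, G.weight u v *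
          ∫ θ in (0 : ℝ)..1, b (z u) (z v) (G.σ u v) θ := by
        rw [intervalIntegral.integral_const_mul,
          intervalIntegral.integral_finsetSum fun u _ => hint' u]
        congr 1
        refine Finset.sum_congr rfl fun u _ => ?_
        rw [intervalIntegral.integral_finsetSum fun v _ => hint u v]
        exact Finset.sum_congr rfl fun v _ => intervalIntegral.integral_const_mul _ _
    _ ≤ (1 / 2) * ∑ u ∈ X, ∑ v ∈ X, G.weight u v *
          (Real.pi / 2 * ‖(z u : ℂ) - ((G.σ u v : Circle) : ℂ) * z v‖) := by
        gcongr with u _ v _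
        · exact G.weight_nonneg u v
        · exact hbi _ _ _
    _ = _ := by
        rw [mul_left_comm]
        simp only [Finset.mul_sum]
        exact Finset.sum_congr rfl fun u _ => Finset.sum_congr rfl fun v _ => by ring

end MagneticGraph

/-! ### Coarea argument, Sobolev and Nash inequalities -/

/-- Rests on the identity `‖a z - b w‖² = (a - b)² + a b ‖z - w‖²` for unit `z`, `w`. -/
theorem min_mul_norm_sub_le {a b : ℝ} (ha : 0 ≤ a) (hb : 0 ≤ b) {z w : ℂ} (hz : ‖z‖ = 1)
    (hw : ‖w‖ = 1) : min a b * ‖z - w‖ ≤ ‖(a : ℂ) * z - b * w‖ := by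
  have hmin : 0 ≤ min a b := le_min ha hb
  refine le_of_sq_le_sq ?_ (norm_nonneg _)
  have hz2 : z.re * z.re + z.im * z.im = 1 := by
    rw [← Complex.normSq_apply, Complex.normSq_eq_norm_sq, hz, one_pow]
  have hw2 : w.re * w.re + w.im * w.im = 1 := by
    rw [← Complex.normSq_apply, Complex.normSq_eq_norm_sq, hw, one_pow]
  have key : ‖(a : ℂ) * z - b * w‖ ^ 2 = (a - b) ^ 2 + a * b * ‖z - w‖ ^ 2 := by
    rw [Complex.sq_norm, Complex.sq_norm, Complex.normSq_apply, Complex.normSq_apply]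
    simp only [Complex.sub_re, Complex.sub_im, Complex.re_ofReal_mul, Complex.im_ofReal_mul]
    linear_combination (a ^ 2 - a * b) * hz2 + (b ^ 2 - a * b) * hw2
  have hmm : min a b * min a b ≤ a * b :=
    mul_le_mul (min_le_left a b) (min_le_right a b) hmin ha
  rw [key, mul_pow, pow_two (min a b)]
  nlinarith [sq_nonneg (a - b), mul_le_mul_of_nonneg_right hmm (sq_nonneg ‖z - w‖)]

theorem integral_ite_lt {s₀ S a : ℝ} (hs : s₀ ≤ S) (ha : a ≤ S) :
    ∫ s in s₀..S, (if s < a then (1 : ℝ) else 0) = max (a - s₀) 0 := by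
  rw [intervalIntegral.integral_of_le hs]
  have h : (fun s : ℝ => if s < a then (1 : ℝ) else 0) = (Set.Iio a).indicator 1 := by
    ext s; simp [Set.indicator]
  rw [h, MeasureTheory.integral_indicator_one measurableSet_Iio,
    MeasureTheory.measureReal_restrict_apply measurableSet_Iio]
  rcases lt_or_ge a S with haS | haS
  · have : Set.Iio a ∩ Set.Ioc s₀ S = Set.Ioo s₀ a := by
      ext s
      simp only [Set.mem_inter_iff, Set.mem_Iio, Set.mem_Ioc, Set.mem_Ioo]
      exact ⟨fun h => ⟨h.2.1, h.1⟩, fun h => ⟨h.2, h.1, by linarith [h.2]⟩⟩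
    rw [this, Real.volume_real_Ioo]
  · obtain rfl := le_antisymm ha haS
    have : Set.Iio a ∩ Set.Ioc s₀ a = Set.Ioo s₀ a := by
      ext s
      simp only [Set.mem_inter_iff, Set.mem_Iio, Set.mem_Ioc, Set.mem_Ioo]
      exact ⟨fun h => ⟨h.2.1, h.1⟩, fun h => ⟨h.2, h.1, h.2.le⟩⟩
    rw [this, Real.volume_real_Ioo]

theorem intervalIntegrable_ite_lt (s₀ S a : ℝ) :
    IntervalIntegrable (fun s => if s < a then (1 : ℝ) else 0) MeasureTheory.volume s₀ S := by
  refine Antitone.intervalIntegrable fun x y h => ?_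
  split_ifs <;> linarith

namespace MagneticGraph

variable {V : Type*} {Γ : Subgroup Circle}

/-- Dirichlet energy of the magnetic graph. -/
noncomputable def energy [Fintype V] (G : MagneticGraph V Γ) (g : V → ℂ) : ℝ :=
  (1 / 2) * ∑ u, ∑ v, G.weight u v * ‖g u - ((G.σ u v : Circle) : ℂ) * g v‖ ^ 2

/-- Isoperimetry is written with indicators so that the level `s` can be integrated edge by edge.
The indicator of the minimum selects edges inside the superlevel set, and the difference of
indicators selects edges leaving it. The factor `π/4` is the rounding loss `π/2` times `1/2` for
ordered pairs. -/
theorem isoperimetry_superlevel [Fintype V] (hΓ : IsSignatureGroup Γ) {G : MagneticGraph V Γ}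
    {δ c : ℝ} (hδ : 1 < δ) (hG : G.HasIsoperimetricDimension δ c) (h : V → ℝ) (z : V → Circle)
    (s : ℝ) :
    c * G.vol {u | s < h u} ^ ((δ - 1) / δ) ≤ ∑ u, ∑ v, G.weight u v *
      (Real.pi / 4 * ‖(z u : ℂ) - ((G.σ u v : Circle) : ℂ) * z v‖ *
          (if s < min (h u) (h v) then 1 else 0) +
        ((if s < h u then 1 else 0) - if s < min (h u) (h v) then 1 else 0)) := by
  classical
  set X : Finset V := {u | s < h u} with hX
  have hmem : ∀ u, u ∈ X ↔ s < h u := fun u => by simp [hX]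
  have hmin : ∀ u v, (if s < min (h u) (h v) then (1 : ℝ) else 0) =
      if u ∈ X then if v ∈ X then 1 else 0 else 0 := fun u v => by
    simp only [lt_min_iff, hmem]
    split_ifs <;> simp_all
  have hrhs : (∑ u, ∑ v, G.weight u v *
      (Real.pi / 4 * ‖(z u : ℂ) - ((G.σ u v : Circle) : ℂ) * z v‖ *
          (if s < min (h u) (h v) then 1 else 0) +
        ((if s < h u then 1 else 0) - if s < min (h u) (h v) then 1 else 0))) =
      Real.pi / 2 * ((1 / 2) * ∑ u ∈ X, ∑ v ∈ X, G.weight u v *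
        ‖(z u : ℂ) - ((G.σ u v : Circle) : ℂ) * z v‖) + G.boundary X := by
    rw [boundary_eq, ← Finset.sum_filter_add_sum_filter_not Finset.univ (· ∈ X)]
    have h0 : ∑ u with u ∉ X, ∑ v, G.weight u v *
      (Real.pi / 4 * ‖(z u : ℂ) - ((G.σ u v : Circle) : ℂ) * z v‖ *
          (if s < min (h u) (h v) then 1 else 0) +
        ((if s < h u then 1 else 0) - if s < min (h u) (h v) then 1 else 0)) = 0 := by
      refine Finset.sum_eq_zero fun u hu => Finset.sum_eq_zero fun v _ => ?_
      have hu' := (Finset.mem_filter.1 hu).2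
      rw [hmin, if_neg hu', if_neg fun h' => hu' ((hmem u).2 h')]
      ring
    rw [h0, add_zero, Finset.filter_univ_mem]
    simp only [Finset.mul_sum]
    rw [← Finset.sum_add_distrib]
    refine Finset.sum_congr rfl fun u hu => ?_
    rw [← Finset.sum_add_sum_compl X]
    congr 1
    · refine Finset.sum_congr rfl fun v hv => ?_
      rw [hmin, if_pos hu, if_pos hv, if_pos ((hmem u).1 hu)]
      ring
    · refine Finset.sum_congr rfl fun v hv => ?_
      rw [hmin, if_pos hu, if_neg (Finset.mem_compl.1 hv), if_pos ((hmem u).1 hu)]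
      ring
  rw [hrhs]
  rcases X.eq_empty_or_nonempty with hX0 | hX0
  -- Isoperimetry is assumed only for nonempty sets; above the top level both sides vanish.
  · have : (δ - 1) / δ ≠ 0 := (div_pos (by linarith) (by linarith)).ne'
    simp [hX0, vol, boundary, Real.zero_rpow this]
  · refine (hG.2 X hX0).trans ?_
    gcongr
    exact G.frustrationIndex_le hΓ X z

/-- Markov's inequality bounds the volume by `M / r`, where `M = ∑ μ‖g‖`. Splitting off `vol ^
(-1/δ)` then makes the isoperimetric lower bound linear in the volume, ready for integration in `s`.
-/
theorem le_vol_superlevel_rpow [Fintype V] (G : MagneticGraph V Γ) {δ r s : ℝ} (hδ : 1 < δ)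
    (hr : 0 < r) (hs : r ^ 2 ≤ s) (g : V → ℂ) :
    (r / ∑ u, G.μ u * ‖g u‖) ^ (1 / δ) * G.vol {u | s < ‖g u‖ ^ 2} ≤
      G.vol {u | s < ‖g u‖ ^ 2} ^ ((δ - 1) / δ) := by
  set X : Finset V := {u | s < ‖g u‖ ^ 2} with hX
  set M := ∑ u, G.μ u * ‖g u‖
  have hδ0 : 0 < δ := by linarith
  have hpow : (δ - 1) / δ ≠ 0 := (div_pos (by linarith) hδ0).ne'
  have hV0 : 0 ≤ G.vol X := Finset.sum_nonneg fun u _ => (G.μ_pos u).le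
  have hVM : G.vol X * r ≤ M := by
    unfold vol
    rw [Finset.sum_mul]
    refine (Finset.sum_le_sum fun u hu => ?_).trans
      (Finset.sum_le_univ_sum_of_nonneg fun u => mul_nonneg (G.μ_pos u).le (norm_nonneg _))
    have hu' := (Finset.mem_filter.1 hu).2
    exact mul_le_mul_of_nonneg_left (le_of_sq_le_sq (by linarith) (norm_nonneg _)) (G.μ_pos u).le
  rcases hV0.eq_or_lt with h0 | h0
  · rw [← h0, Real.zero_rpow hpow, mul_zero]
  · have hM : 0 < M := lt_of_lt_of_le (by positivity) hVM
    have h1 : r / M ≤ (G.vol X)⁻¹ := by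
      rw [div_le_iff₀ hM, inv_mul_eq_div, le_div_iff₀ h0, mul_comm]
      exact hVM
    calc (r / M) ^ (1 / δ) * G.vol X ≤ (G.vol X)⁻¹ ^ (1 / δ) * G.vol X := by gcongr
      _ = G.vol X ^ ((δ - 1) / δ) := by
        rw [Real.inv_rpow hV0, ← Real.rpow_neg hV0]
        conv_lhs => rw [← Real.rpow_one (G.vol X), ← Real.rpow_mul hV0, ← Real.rpow_add h0]
        congr 1
        field_simp
        ring

/-- Integrated isoperimetric inequality above the level `r ^ 2`. -/
theorem integrated_isoperimetry [Fintype V] (hΓ : IsSignatureGroup Γ) {G : MagneticGraph V Γ}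
    {δ c : ℝ} (hδ : 1 < δ) (hG : G.HasIsoperimetricDimension δ c) {r : ℝ} (hr : 0 < r)
    (g : V → ℂ) (z : V → Circle) :
    c * (r / ∑ u, G.μ u * ‖g u‖) ^ (1 / δ) * ∑ u, G.μ u * max (‖g u‖ ^ 2 - r ^ 2) 0 ≤
      ∑ u, ∑ v, G.weight u v *
        (Real.pi / 4 * ‖(z u : ℂ) - ((G.σ u v : Circle) : ℂ) * z v‖ *
            max (min (‖g u‖ ^ 2) (‖g v‖ ^ 2) - r ^ 2) 0 +
          (max (‖g u‖ ^ 2 - r ^ 2) 0 - max (min (‖g u‖ ^ 2) (‖g v‖ ^ 2) - r ^ 2) 0)) := by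
  -- Any level above all values of `‖g‖ ^ 2` would do: beyond it the superlevel sets are empty.
  set S : ℝ := r ^ 2 + ∑ u, ‖g u‖ ^ 2 with hS
  have hgS : ∀ u, ‖g u‖ ^ 2 ≤ S := fun u => by
    have := Finset.single_le_sum (f := fun u => ‖g u‖ ^ 2) (fun u _ => sq_nonneg _)
      (Finset.mem_univ u)
    have h2 := sq_nonneg r
    linarith
  have hrS : r ^ 2 ≤ S := le_add_of_nonneg_right (Finset.sum_nonneg fun u _ => sq_nonneg _)
  set B := (r / ∑ u, G.μ u * ‖g u‖) ^ (1 / δ)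
  have hi : ∀ a, IntervalIntegrable (fun s => if s < a then (1 : ℝ) else 0)
    MeasureTheory.volume (r ^ 2) S := fun a => intervalIntegrable_ite_lt _ _ a
  have hL : ∀ u, IntervalIntegrable (fun s => G.μ u * if s < ‖g u‖ ^ 2 then (1 : ℝ) else 0)
    MeasureTheory.volume (r ^ 2) S := fun u => (hi _).const_mul _
  have hR : ∀ u v, IntervalIntegrable (fun s => G.weight u v *
      (Real.pi / 4 * ‖(z u : ℂ) - ((G.σ u v : Circle) : ℂ) * z v‖ *
          (if s < min (‖g u‖ ^ 2) (‖g v‖ ^ 2) then 1 else 0) +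
        ((if s < ‖g u‖ ^ 2 then 1 else 0) -
          if s < min (‖g u‖ ^ 2) (‖g v‖ ^ 2) then 1 else 0)))
      MeasureTheory.volume (r ^ 2) S := fun u v =>
    (((hi _).const_mul _).add ((hi _).sub (hi _))).const_mul _
  have hR' : ∀ u, IntervalIntegrable (fun s => ∑ v, G.weight u v *
      (Real.pi / 4 * ‖(z u : ℂ) - ((G.σ u v : Circle) : ℂ) * z v‖ *
          (if s < min (‖g u‖ ^ 2) (‖g v‖ ^ 2) then 1 else 0) +
        ((if s < ‖g u‖ ^ 2 then 1 else 0) -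
          if s < min (‖g u‖ ^ 2) (‖g v‖ ^ 2) then 1 else 0)))
      MeasureTheory.volume (r ^ 2) S := fun u => by
    have h := IntervalIntegrable.sum Finset.univ fun v _ => hR u v
    rwa [Finset.sum_fn] at h
  have hR'' := IntervalIntegrable.sum Finset.univ fun u _ => hR' u
  have hL' := IntervalIntegrable.sum Finset.univ fun u _ => hL u
  rw [Finset.sum_fn] at hR'' hL'
  have key := intervalIntegral.integral_mono_on hrS (hL'.const_mul (c * B)) hR'' fun s hs => by
    have h1 := isoperimetry_superlevel hΓ hδ hG (fun u => ‖g u‖ ^ 2) z s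
    refine le_trans ?_ h1
    have h2 := G.le_vol_superlevel_rpow hδ hr hs.1 g
    have h3 : ∑ u, G.μ u * (if s < ‖g u‖ ^ 2 then (1 : ℝ) else 0) =
        G.vol {u | s < ‖g u‖ ^ 2} := by
      unfold vol
      rw [Finset.sum_filter]
      exact Finset.sum_congr rfl fun u _ => by split_ifs <;> simp
    rw [h3, mul_assoc]
    exact mul_le_mul_of_nonneg_left h2 hG.1.le
  rw [intervalIntegral.integral_const_mul, intervalIntegral.integral_finsetSum fun u _ => hL u,
    intervalIntegral.integral_finsetSum fun u _ => hR' u] at key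
  refine (le_of_eq ?_).trans (key.trans_eq ?_)
  · congr 1
    refine Finset.sum_congr rfl fun u _ => ?_
    rw [intervalIntegral.integral_const_mul, integral_ite_lt hrS (hgS u)]
  · refine Finset.sum_congr rfl fun u _ => ?_
    rw [intervalIntegral.integral_finsetSum fun v _ => hR u v]
    refine Finset.sum_congr rfl fun v _ => ?_
    have hm : min (‖g u‖ ^ 2) (‖g v‖ ^ 2) ≤ S := (min_le_right _ _).trans (hgS v)
    rw [intervalIntegral.integral_const_mul,
      intervalIntegral.integral_add ((hi _).const_mul _) ((hi _).sub (hi _)),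
      intervalIntegral.integral_const_mul, intervalIntegral.integral_sub (hi _) (hi _),
      integral_ite_lt hrS (hgS _), integral_ite_lt hrS hm]

/-- One factor of the minimum turns the phase difference into `‖g - σ g'‖`, the other is at most the
mean modulus. The second part is a difference of squares with the reverse triangle inequality. -/
theorem edge_pair_bound {g g' σ : ℂ} (hσ : ‖σ‖ = 1) {z z' : ℂ} (hz : ‖z‖ = 1)
    (hz' : ‖z'‖ = 1) (hg : g = ‖g‖ * z) (hg' : g' = ‖g'‖ * z') :
    min (‖g‖ ^ 2) (‖g'‖ ^ 2) * ‖z - σ * z'‖ ≤ (‖g‖ + ‖g'‖) / 2 * ‖g - σ * g'‖ ∧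
      |‖g‖ ^ 2 - ‖g'‖ ^ 2| ≤ (‖g‖ + ‖g'‖) * ‖g - σ * g'‖ := by
  have ha := norm_nonneg g
  have hb := norm_nonneg g'
  have h1 := min_mul_norm_sub_le ha hb hz (w := σ * z') (by rw [norm_mul, hσ, hz', one_mul])
  rw [← hg, mul_left_comm, ← hg'] at h1
  constructor
  · have h2 : min (‖g‖ ^ 2) (‖g'‖ ^ 2) = min ‖g‖ ‖g'‖ * min ‖g‖ ‖g'‖ := by
      rcases le_total ‖g‖ ‖g'‖ with h | h
      · rw [min_eq_left h, min_eq_left (by gcongr), pow_two]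
      · rw [min_eq_right h, min_eq_right (by gcongr), pow_two]
    rw [h2, mul_assoc]
    refine mul_le_mul ?_ h1 (by positivity) (by positivity)
    linarith [min_le_left ‖g‖ ‖g'‖, min_le_right ‖g‖ ‖g'‖]
  · rw [sq_sub_sq, abs_mul, abs_of_nonneg (add_nonneg ha hb)]
    gcongr
    have := abs_norm_sub_norm_le g (σ * g')
    rwa [norm_mul, hσ, one_mul] at this

theorem sum_sum_weight_swap [Fintype V] (G : MagneticGraph V Γ) (F : V → V → ℝ) :
    ∑ u, ∑ v, G.weight u v * F u v = ∑ u, ∑ v, G.weight u v * F v u := by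
  rw [Finset.sum_comm]
  exact Finset.sum_congr rfl fun u _ => Finset.sum_congr rfl fun v _ => by rw [G.weight_symm]

theorem degree_le [Fintype V] [Nonempty V] (G : MagneticGraph V Γ) (u : V) :
    G.degree u ≤ G.maxDegree * G.μ u := by
  rw [← div_le_iff₀ (G.μ_pos u)]
  exact Finset.le_sup' (fun u => G.degree u / G.μ u) (Finset.mem_univ u)

/-- Of the constant `8`, a factor `4` comes from `(a + b)² ≤ 2a² + 2b²` summed over both
orientations, and a factor `2` undoes the `1/2` in the energy. -/
theorem cauchy_schwarz_edges [Fintype V] [Nonempty V] (G : MagneticGraph V Γ) (g : V → ℂ) :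
    (∑ u, ∑ v, G.weight u v *
      ((‖g u‖ + ‖g v‖) * ‖g u - ((G.σ u v : Circle) : ℂ) * g v‖)) ^ 2 ≤
      8 * G.maxDegree * (∑ u, G.μ u * ‖g u‖ ^ 2) * G.energy g := by
  have hCS : (∑ u, ∑ v, G.weight u v *
      ((‖g u‖ + ‖g v‖) * ‖g u - ((G.σ u v : Circle) : ℂ) * g v‖)) ^ 2 ≤
      (∑ u, ∑ v, G.weight u v * (‖g u‖ + ‖g v‖) ^ 2) *
        ∑ u, ∑ v, G.weight u v * ‖g u - ((G.σ u v : Circle) : ℂ) * g v‖ ^ 2 := by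
    simp only [← Fintype.sum_prod_type']
    refine Finset.sum_sq_le_sum_mul_sum_of_sq_le_mul _ (fun i _ => ?_) (fun i _ => ?_)
      fun i _ => ?_
    · exact mul_nonneg (G.weight_nonneg _ _) (sq_nonneg _)
    · exact mul_nonneg (G.weight_nonneg _ _) (sq_nonneg _)
    · exact le_of_eq (by ring)
  have h1 : ∑ u, ∑ v, G.weight u v * (‖g u‖ + ‖g v‖) ^ 2 ≤
      4 * (G.maxDegree * ∑ u, G.μ u * ‖g u‖ ^ 2) := by
    calc ∑ u, ∑ v, G.weight u v * (‖g u‖ + ‖g v‖) ^ 2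
        ≤ ∑ u, ∑ v, (G.weight u v * (2 * ‖g u‖ ^ 2) + G.weight u v * (2 * ‖g v‖ ^ 2)) := by
          refine Finset.sum_le_sum fun u _ => Finset.sum_le_sum fun v _ => ?_
          rw [← mul_add]
          refine mul_le_mul_of_nonneg_left ?_ (G.weight_nonneg u v)
          nlinarith [sq_nonneg (‖g u‖ - ‖g v‖)]
      _ = 4 * ∑ u, G.degree u * ‖g u‖ ^ 2 := by
          simp only [Finset.sum_add_distrib]
          rw [← G.sum_sum_weight_swap fun u _ => 2 * ‖g u‖ ^ 2]
          simp only [← Finset.sum_mul, ← degree_eq]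
          rw [← Finset.sum_add_distrib, Finset.mul_sum]
          exact Finset.sum_congr rfl fun u _ => by ring
      _ ≤ _ := by
          refine mul_le_mul_of_nonneg_left ?_ (by norm_num)
          rw [Finset.mul_sum]
          refine Finset.sum_le_sum fun u _ => ?_
          rw [← mul_assoc]
          exact mul_le_mul_of_nonneg_right (G.degree_le u) (sq_nonneg _)
  refine hCS.trans ((mul_le_mul_of_nonneg_right h1 ?_).trans_eq ?_)
  · exact Finset.sum_nonneg fun u _ => Finset.sum_nonneg fun v _ =>
      mul_nonneg (G.weight_nonneg _ _) (sq_nonneg _)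
  · unfold energy
    ring

/-- The frustration and boundary terms each cost half of the right-hand side: the first because `π/4
≤ 1`, the second by symmetrizing over orientations. -/
theorem truncated_sobolev [Fintype V] (hΓ : IsSignatureGroup Γ) {G : MagneticGraph V Γ}
    {δ c : ℝ} (hδ : 1 < δ) (hG : G.HasIsoperimetricDimension δ c) {r : ℝ} (hr : 0 < r)
    (g : V → ℂ) :
    c * (r / ∑ u, G.μ u * ‖g u‖) ^ (1 / δ) * ∑ u, G.μ u * max (‖g u‖ ^ 2 - r ^ 2) 0 ≤
      ∑ u, ∑ v, G.weight u v *
        ((‖g u‖ + ‖g v‖) * ‖g u - ((G.σ u v : Circle) : ℂ) * g v‖) := by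
  have hz : ∀ u, g u = ‖g u‖ * (Circle.exp (Complex.arg (g u)) : ℂ) := fun u => by
    rw [Circle.coe_exp, Complex.norm_mul_exp_arg_mul_I]
  refine (integrated_isoperimetry hΓ hδ hG hr g fun u => Circle.exp (Complex.arg (g u))).trans ?_
  set z : V → Circle := fun u => Circle.exp (Complex.arg (g u)) with hzdef
  have hpi : Real.pi ≤ 4 := Real.pi_le_four
  set D : V → V → ℝ := fun u v => (‖g u‖ + ‖g v‖) * ‖g u - ((G.σ u v : Circle) : ℂ) * g v‖ with hD
  have hpair := fun u v => edge_pair_bound (Circle.norm_coe (G.σ u v : Circle))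
    (Circle.norm_coe (z u)) (Circle.norm_coe (z v)) (hz u) (hz v)
  have hsymm : ∑ u, ∑ v, G.weight u v * (max (‖g u‖ ^ 2 - r ^ 2) 0 -
      max (min (‖g u‖ ^ 2) (‖g v‖ ^ 2) - r ^ 2) 0) ≤
      ∑ u, ∑ v, G.weight u v * (1 / 2 * D u v) := by
    set T := ∑ u, ∑ v, G.weight u v * (max (‖g u‖ ^ 2 - r ^ 2) 0 -
      max (min (‖g u‖ ^ 2) (‖g v‖ ^ 2) - r ^ 2) 0) with hT
    have hT' := hT
    rw [G.sum_sum_weight_swap fun u v => max (‖g u‖ ^ 2 - r ^ 2) 0 -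
      max (min (‖g u‖ ^ 2) (‖g v‖ ^ 2) - r ^ 2) 0] at hT'
    -- Adding the two orientations of an edge leaves the absolute difference of the truncated
    -- values, since the endpoint attaining the minimum contributes zero. Truncation only shrinks
    -- differences.
    have h2 : T + T ≤ ∑ u, ∑ v, G.weight u v * D u v := by
      conv_lhs => rw [hT]
      nth_rewrite 2 [← hT]
      rw [hT']
      simp only [← Finset.sum_add_distrib, ← mul_add]
      refine Finset.sum_le_sum fun u _ => Finset.sum_le_sum fun v _ =>
        mul_le_mul_of_nonneg_left ((le_trans ?_ (hpair u v).2)) (G.weight_nonneg u v)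
      rw [min_comm (‖g v‖ ^ 2)]
      generalize ‖g u‖ ^ 2 = a
      generalize ‖g v‖ ^ 2 = b
      rcases le_total a b with h | h
      · rw [min_eq_left h, abs_sub_comm, abs_of_nonneg (by linarith)]
        rcases max_cases (a - r ^ 2) 0 with h1 | h1 <;>
          rcases max_cases (b - r ^ 2) 0 with h2 | h2 <;> linarith
      · rw [min_eq_right h, abs_of_nonneg (by linarith)]
        rcases max_cases (a - r ^ 2) 0 with h1 | h1 <;>
          rcases max_cases (b - r ^ 2) 0 with h2 | h2 <;> linarith
    have h3 : ∑ u, ∑ v, G.weight u v * (1 / 2 * D u v) =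
        1 / 2 * ∑ u, ∑ v, G.weight u v * D u v := by
      simp only [Finset.mul_sum]
      exact Finset.sum_congr rfl fun u _ => Finset.sum_congr rfl fun v _ => by ring
    rw [h3]
    linarith
  calc _ ≤ ∑ u, ∑ v, (G.weight u v * (1 / 2 * D u v) +
        G.weight u v * (max (‖g u‖ ^ 2 - r ^ 2) 0 -
          max (min (‖g u‖ ^ 2) (‖g v‖ ^ 2) - r ^ 2) 0)) := by
        refine Finset.sum_le_sum fun u _ => Finset.sum_le_sum fun v _ => ?_
        rw [← mul_add]
        refine mul_le_mul_of_nonneg_left ?_ (G.weight_nonneg u v)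
        refine add_le_add ?_ le_rfl
        have h1 := (hpair u v).1
        have h2 : max (min (‖g u‖ ^ 2) (‖g v‖ ^ 2) - r ^ 2) 0 ≤ min (‖g u‖ ^ 2) (‖g v‖ ^ 2) :=
          max_le (by linarith [sq_nonneg r]) (le_min (sq_nonneg _) (sq_nonneg _))
        have h3 := norm_nonneg ((z u : ℂ) - ((G.σ u v : Circle) : ℂ) * z v)
        calc Real.pi / 4 * ‖(z u : ℂ) - ((G.σ u v : Circle) : ℂ) * z v‖ *
              max (min (‖g u‖ ^ 2) (‖g v‖ ^ 2) - r ^ 2) 0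
            ≤ 1 * ‖(z u : ℂ) - ((G.σ u v : Circle) : ℂ) * z v‖ *
              min (‖g u‖ ^ 2) (‖g v‖ ^ 2) := by
              gcongr
              linarith
          _ ≤ 1 / 2 * D u v := by
              simp only [hD]
              linarith
    _ ≤ ∑ u, ∑ v, (G.weight u v * (1 / 2 * D u v) + G.weight u v * (1 / 2 * D u v)) := by
        simp only [Finset.sum_add_distrib]
        linarith
    _ = _ := Finset.sum_congr rfl fun u _ => Finset.sum_congr rfl fun v _ => by ring

/-- Nash inequality. -/
theorem nash [Fintype V] [Nonempty V] (hΓ : IsSignatureGroup Γ) {G : MagneticGraph V Γ}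
    {δ c : ℝ} (hδ : 1 < δ) (hG : G.HasIsoperimetricDimension δ c) {g : V → ℂ} (hg : g ≠ 0) :
    c ^ 2 * (∑ u, G.μ u * ‖g u‖ ^ 2) *
        ((∑ u, G.μ u * ‖g u‖ ^ 2) / (2 * (∑ u, G.μ u * ‖g u‖) ^ 2)) ^ (2 / δ) ≤
      32 * G.maxDegree * G.energy g := by
  obtain ⟨u₀, hu₀⟩ := Function.ne_iff.1 hg
  have hn : 0 < ‖g u₀‖ := norm_pos_iff.2 hu₀
  set N := ∑ u, G.μ u * ‖g u‖ ^ 2 with hN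
  set M := ∑ u, G.μ u * ‖g u‖ with hM
  have hN0 : 0 < N := Finset.sum_pos' (fun u _ => mul_nonneg (G.μ_pos u).le (sq_nonneg _))
    ⟨u₀, Finset.mem_univ _, mul_pos (G.μ_pos _) (by positivity)⟩
  have hM0 : 0 < M := Finset.sum_pos' (fun u _ => mul_nonneg (G.μ_pos u).le (norm_nonneg _))
    ⟨u₀, Finset.mem_univ _, mul_pos (G.μ_pos _) hn⟩
  -- Chosen so that `r * M = N / 2`. Since `max (x² - r²) 0 ≥ x² - r x` for `x ≥ 0`, truncation
  -- keeps at least half of `N`.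
  set r := N / (2 * M) with hr
  have hr0 : 0 < r := by positivity
  have h1 := truncated_sobolev hΓ hδ hG hr0 g
  have h2 := G.cauchy_schwarz_edges g
  have h3 : N / 2 ≤ ∑ u, G.μ u * max (‖g u‖ ^ 2 - r ^ 2) 0 := by
    have h4 : N / 2 = ∑ u, G.μ u * (‖g u‖ ^ 2 - r * ‖g u‖) := by
      have : ∑ u, G.μ u * (‖g u‖ ^ 2 - r * ‖g u‖) = N - r * M := by
        rw [hN, hM, Finset.mul_sum, ← Finset.sum_sub_distrib]
        exact Finset.sum_congr rfl fun u _ => by ring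
      rw [this, hr]
      field_simp
      ring
    rw [h4]
    refine Finset.sum_le_sum fun u _ => mul_le_mul_of_nonneg_left ?_ (G.μ_pos u).le
    rcases le_total r ‖g u‖ with h | h
    · refine le_max_of_le_left ?_
      nlinarith
    · refine le_max_of_le_right ?_
      nlinarith [norm_nonneg (g u)]
  set B := (r / M) ^ (1 / δ) with hB
  have hB0 : 0 < B := by positivity
  have hBB : (N / (2 * M ^ 2)) ^ (2 / δ) = B ^ 2 := by
    rw [hB, ← Real.rpow_natCast ((r / M) ^ (1 / δ)) 2, ← Real.rpow_mul (by positivity)]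
    congr 1
    · rw [hr]
      field_simp
    · push_cast
      ring
  have h5 : c * B * (N / 2) ≤ _ := (mul_le_mul_of_nonneg_left h3
    (mul_nonneg hG.1.le hB0.le)).trans h1
  have h6 : (c * B * (N / 2)) ^ 2 ≤ 8 * G.maxDegree * N * G.energy g :=
    (pow_le_pow_left₀ (mul_nonneg (mul_nonneg hG.1.le hB0.le) (by positivity)) h5 2).trans h2
  rw [hBB]
  refine le_of_mul_le_mul_right ?_ hN0
  calc c ^ 2 * N * B ^ 2 * N = 4 * (c * B * (N / 2)) ^ 2 := by ring
    _ ≤ 4 * (8 * G.maxDegree * N * G.energy g) := by gcongr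
    _ = _ := by ring

end MagneticGraph

/-! ### Functional calculus of a Hermitian matrix -/

namespace Matrix.IsHermitian

variable {n : Type*} [Fintype n] [DecidableEq n] {A : Matrix n n ℂ} (hA : A.IsHermitian)

theorem cfc_eq_conj (φ : ℝ → ℝ) : hA.cfc φ = Unitary.conjStarAlgAut ℂ _ hA.eigenvectorUnitary
    (diagonal fun j => (φ (hA.eigenvalues j) : ℂ)) := rfl

theorem cfc_self : hA.cfc (fun x => x) = A := hA.spectral_theorem.symm

theorem cfc_mul (φ ψ : ℝ → ℝ) : hA.cfc (fun x => φ x * ψ x) = hA.cfc φ * hA.cfc ψ := by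
  simp only [cfc_eq_conj, ← map_mul, diagonal_mul_diagonal, Complex.ofReal_mul]

theorem cfc_pow (φ : ℝ → ℝ) (k : ℕ) : hA.cfc (fun x => φ x ^ k) = hA.cfc φ ^ k := by
  simp only [cfc_eq_conj, ← map_pow, diagonal_pow, Complex.ofReal_pow]
  rfl

theorem cfc_one_add_mul (a : ℝ) : hA.cfc (fun x => 1 + a * x) = 1 + (a : ℂ) • A := by
  conv_rhs => rw [← hA.cfc_self]
  rw [cfc_eq_conj, cfc_eq_conj, ← map_smul, ← map_one (Unitary.conjStarAlgAut ℂ _ hA.eigenvectorUnitary),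
    ← map_add, ← diagonal_one, ← diagonal_smul, diagonal_add]
  congr! 3
  simp

theorem conjTranspose_cfc (φ : ℝ → ℝ) : (hA.cfc φ)ᴴ = hA.cfc φ := by
  rw [← star_eq_conjTranspose, cfc_eq_conj, ← map_star, star_eq_conjTranspose, diagonal_conjTranspose]
  congr! 2
  funext j
  simp

theorem trace_cfc (φ : ℝ → ℝ) : (hA.cfc φ).trace = ((∑ j, φ (hA.eigenvalues j) : ℝ) : ℂ) := by
  rw [cfc_eq_conj, Unitary.conjStarAlgAut_apply, trace_mul_cycle]
  simp

theorem cfc_apply (φ : ℝ → ℝ) (u v : n) :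
    hA.cfc φ u v = ∑ j, (hA.eigenvectorUnitary : Matrix n n ℂ) u j * φ (hA.eigenvalues j) *
      star ((hA.eigenvectorUnitary : Matrix n n ℂ) v j) := by
  rw [cfc_eq_conj, Unitary.conjStarAlgAut_apply, mul_apply]
  refine Finset.sum_congr rfl fun j _ => ?_
  rw [mul_diagonal, star_apply]

theorem cfc_apply_self (φ : ℝ → ℝ) (u : n) :
    hA.cfc φ u u = ((∑ j, ‖(hA.eigenvectorUnitary : Matrix n n ℂ) u j‖ ^ 2 *
      φ (hA.eigenvalues j) : ℝ) : ℂ) := by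
  rw [cfc_apply]
  push_cast
  refine Finset.sum_congr rfl fun j _ => ?_
  rw [← Complex.mul_conj', RCLike.star_def]
  ring

theorem sum_norm_sq_cfc (φ : ℝ → ℝ) (u : n) :
    ((∑ v, ‖hA.cfc φ v u‖ ^ 2 : ℝ) : ℂ) = hA.cfc (fun x => φ x * φ x) u u := by
  rw [cfc_mul, mul_apply]
  push_cast
  refine Finset.sum_congr rfl fun v _ => ?_
  have h : hA.cfc φ u v = star (hA.cfc φ v u) := by
    rw [← conjTranspose_apply, conjTranspose_cfc]
  rw [h, RCLike.star_def, ← Complex.conj_mul']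

theorem exp_smul_eq_cfc (t : ℝ) :
    NormedSpace.exp (-(t : ℂ) • A) = hA.cfc fun x => Real.exp (-x * t) := by
  have h : -(t : ℂ) • A = (Unitary.toUnits hA.eigenvectorUnitary : Matrix n n ℂ) *
      diagonal (fun j => ((-hA.eigenvalues j * t : ℝ) : ℂ)) *
      ((Unitary.toUnits hA.eigenvectorUnitary)⁻¹ : (Matrix n n ℂ)ˣ) := by
    conv_lhs =>
      rw [← hA.cfc_self, cfc_eq_conj, ← map_smul, Unitary.conjStarAlgAut_apply, ← diagonal_smul]
    congr! 3
    funext j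
    simp [mul_comm]
  rw [h, exp_units_conj, exp_diagonal, cfc_eq_conj, Unitary.conjStarAlgAut_apply]
  congr! 3
  funext j
  rw [Pi.coe_exp, ← Complex.exp_eq_exp_ℂ, Complex.ofReal_exp]

end Matrix.IsHermitian

/-! ### Weighted row sums of powers, and a differential inequality -/

/-- Entrywise `|P ^ k| ≤ |P| ^ k`, and a nonnegative `m` with `|P| m ≤ m` stays so under iteration.
-/
theorem Matrix.sum_norm_pow_mul_le {n : Type*} [Fintype n] [DecidableEq n] {P : Matrix n n ℂ}
    {m : n → ℝ} (hP : ∀ u, ∑ v, ‖P u v‖ * m v ≤ m u) (hm : ∀ u, 0 ≤ m u) (k : ℕ) (u : n) :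
    ∑ v, ‖(P ^ k) u v‖ * m v ≤ m u := by
  induction k generalizing u with
  | zero =>
    rw [pow_zero, Finset.sum_eq_single u]
    · simp
    · intro v _ hv
      simp [Matrix.one_apply_ne hv.symm]
    · simp
  | succ k ih =>
    calc ∑ v, ‖(P ^ (k + 1)) u v‖ * m v
        ≤ ∑ v, (∑ x, ‖P u x‖ * ‖(P ^ k) x v‖) * m v := by
          refine Finset.sum_le_sum fun v _ => mul_le_mul_of_nonneg_right ?_ (hm v)
          rw [pow_succ', Matrix.mul_apply]
          exact (norm_sum_le _ _).trans_eq (Finset.sum_congr rfl fun x _ => norm_mul _ _)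
      _ = ∑ x, ‖P u x‖ * ∑ v, ‖(P ^ k) x v‖ * m v := by
          simp only [Finset.sum_mul, Finset.mul_sum]
          rw [Finset.sum_comm]
          exact Finset.sum_congr rfl fun x _ => Finset.sum_congr rfl fun v _ => by ring
      _ ≤ ∑ x, ‖P u x‖ * m x := by
          gcongr with x
          exact ih x
      _ ≤ m u := hP u

/-- A Bernoulli-type differential inequality. -/
theorem le_rpow_of_deriv_le {k q : ℝ → ℝ} {a p : ℝ} (ha : 0 < a) (hp : 0 < p)
    (hk : ∀ t, HasDerivAt k (-q t) t) (hpos : ∀ t, 0 < k t)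
    (hq : ∀ t, 0 ≤ t → a * k t * k t ^ p ≤ q t) {t : ℝ} (ht : 0 < t) :
    k t ≤ (p * a * t) ^ (-p⁻¹) := by
  have hder : ∀ s, HasDerivAt (fun s => k s ^ (-p) - p * a * s)
      (-q s * (-p) * k s ^ (-p - 1) - p * a) s := fun s =>
    ((hk s).rpow_const (Or.inl (hpos s).ne')).sub
      (by simpa using (hasDerivAt_id s).const_mul (p * a))
  -- Dividing `-k' ≥ a k ^ (1 + p)` by `k ^ (1 + p)` shows that `k ^ (-p)` grows at rate at least `p
  -- * a`.
  have hmono : MonotoneOn (fun s => k s ^ (-p) - p * a * s) (Set.Ici 0) := by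
    refine monotoneOn_of_deriv_nonneg (convex_Ici 0)
      (fun s _ => (hder s).continuousAt.continuousWithinAt)
      (fun s _ => (hder s).differentiableAt.differentiableWithinAt) fun s hs => ?_
    rw [interior_Ici] at hs
    rw [(hder s).deriv]
    have h1 : a * k s * k s ^ p * k s ^ (-p - 1) = a := by
      rw [mul_assoc, ← Real.rpow_add (hpos s), show p + (-p - 1) = -1 by ring, Real.rpow_neg_one,
        mul_assoc, mul_inv_cancel₀ (hpos s).ne', mul_one]
    have h2 := mul_le_mul_of_nonneg_right (hq s (le_of_lt hs))
      (Real.rpow_nonneg (hpos s).le (-p - 1))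
    rw [h1] at h2
    nlinarith
  have h0 := hmono (Set.mem_Ici.2 le_rfl) (Set.mem_Ici.2 ht.le) ht.le
  have h1 : 0 < k 0 ^ (-p) := Real.rpow_pos_of_pos (hpos 0) _
  have h2 : p * a * t ≤ k t ^ (-p) := by
    simp only at h0
    linarith
  have h3 := Real.rpow_le_rpow_of_nonpos (z := -p⁻¹) (by positivity) h2
    (by simpa using hp.le)
  rwa [← Real.rpow_mul (hpos t).le, neg_mul_neg, mul_inv_cancel₀ hp.ne', Real.rpow_one] at h3

/-! ### Energy form and `ℓ¹` contraction -/

namespace MagneticGraph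

variable {V : Type*} {Γ : Subgroup Circle}

theorem sqrt_μ_pos (G : MagneticGraph V Γ) (u : V) : 0 < √(G.μ u) := Real.sqrt_pos.2 (G.μ_pos u)

variable [Fintype V]

theorem laplacian_apply (G : MagneticGraph V Γ) (f : V → ℂ) (u : V) :
    G.laplacian f u = 1 / (√(G.μ u) : ℂ) * ∑ v, (G.weight u v : ℂ) *
      (f u / (√(G.μ u) : ℂ) - ((G.σ u v : Circle) : ℂ) * (f v / (√(G.μ v) : ℂ))) := by
  classical
  simp only [laplacian, LinearMap.coe_mk, AddHom.coe_mk, weight, Finset.sum_filter]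
  congr 1
  refine Finset.sum_congr rfl fun v _ => ?_
  split_ifs <;> simp

/-- The quadratic form of the magnetic Laplacian is the energy of `f / √μ`. -/
theorem re_sum_conj_mul_laplacian (G : MagneticGraph V Γ) (f : V → ℂ) :
    (∑ u, star (f u) * G.laplacian f u).re = G.energy fun u => f u / (√(G.μ u) : ℂ) := by
  set g : V → ℂ := fun u => f u / (√(G.μ u) : ℂ) with hg
  set F : V → V → ℝ := fun u v => (star (g u) * (g u - ((G.σ u v : Circle) : ℂ) * g v)).re with hF
  have h1 : (∑ u, star (f u) * G.laplacian f u).re = ∑ u, ∑ v, G.weight u v * F u v := by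
    rw [Complex.re_sum]
    refine Finset.sum_congr rfl fun u _ => ?_
    rw [laplacian_apply, ← mul_assoc, Finset.mul_sum, Complex.re_sum]
    refine Finset.sum_congr rfl fun v _ => ?_
    have h2 : star (f u) * (1 / (√(G.μ u) : ℂ)) = star (g u) := by
      simp [hg, div_eq_mul_inv]
    rw [h2, mul_left_comm, Complex.re_ofReal_mul]
  -- The two orientations complete the square, because `σ v u` is the conjugate of `σ u v` and has
  -- modulus one.
  have h3 : ∀ u v, G.weight u v * F u v + G.weight u v * F v u =
      G.weight u v * ‖g u - ((G.σ u v : Circle) : ℂ) * g v‖ ^ 2 := fun u v => by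
    by_cases h : G.graph.Adj u v
    · rw [← mul_add]
      congr 1
      have hs : ((G.σ v u : Circle) : ℂ) = star ((G.σ u v : Circle) : ℂ) := by
        rw [G.σ_inv u v h, Subgroup.coe_inv, Circle.coe_inv_eq_conj]
        rfl
      have hn : ((G.σ u v : Circle) : ℂ).re * ((G.σ u v : Circle) : ℂ).re +
          ((G.σ u v : Circle) : ℂ).im * ((G.σ u v : Circle) : ℂ).im = 1 := by
        rw [← Complex.normSq_apply, Circle.normSq_coe]
      simp only [hF, hs, Complex.sq_norm, Complex.normSq_apply, Complex.mul_re, Complex.mul_im,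
        Complex.sub_re, Complex.sub_im, RCLike.star_def, Complex.conj_re, Complex.conj_im]
      linear_combination (-(g v).re ^ 2 - (g v).im ^ 2) * hn
    · simp [weight, h]
  have h4 := G.sum_sum_weight_swap F
  rw [h1, energy]
  simp only [← h3, Finset.sum_add_distrib]
  rw [← h4]
  ring

variable [DecidableEq V]

theorem laplacianMatrix_apply (G : MagneticGraph V Γ) (u v : V) :
    G.laplacianMatrix u v = (if u = v then ((G.degree u / G.μ u : ℝ) : ℂ) else 0) -
      (G.weight u v : ℂ) * ((G.σ u v : Circle) : ℂ) / ((√(G.μ u) : ℂ) * (√(G.μ v) : ℂ)) := by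
  have hu : (√(G.μ u) : ℂ) * (√(G.μ u) : ℂ) = (G.μ u : ℂ) := by
    rw [← Complex.ofReal_mul, Real.mul_self_sqrt (G.μ_pos u).le]
  rw [laplacianMatrix, LinearMap.toMatrix'_apply, laplacian_apply]
  simp only [mul_sub, Finset.sum_sub_distrib]
  congr 1
  · rw [← Finset.sum_mul, ← Complex.ofReal_sum, ← degree_eq]
    split_ifs with h
    · subst h
      push_cast
      rw [← hu]
      simp [div_eq_mul_inv]
      ring
    · simp [h]
  · rw [Finset.sum_eq_single v]
    · simp [div_eq_mul_inv]
      ring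
    · intro x _ hx
      simp [hx]
    · simp

/-- Diamagnetic comparison: unimodular signatures disappear in the moduli, and `ε * d_μ ≤ 1` keeps
the diagonal nonnegative. What remains is the unsigned step, which fixes `√μ`. -/
theorem heat_step_l1_bound [Nonempty V] (G : MagneticGraph V Γ) {ε : ℝ} (hε : 0 ≤ ε)
    (hd : ε * G.maxDegree ≤ 1) (u : V) :
    ∑ v, ‖(1 + ((-ε : ℝ) : ℂ) • G.laplacianMatrix) u v‖ * √(G.μ v) ≤ √(G.μ u) := by
  have hu := G.sqrt_μ_pos u
  have hle : ∀ v, ‖(1 + ((-ε : ℝ) : ℂ) • G.laplacianMatrix) u v‖ * √(G.μ v) ≤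
      (if u = v then (1 - ε * (G.degree u / G.μ u)) * √(G.μ u) else 0) +
        ε * G.weight u v / √(G.μ u) := fun v => by
    have hv := G.sqrt_μ_pos v
    rw [Matrix.add_apply, Matrix.smul_apply, laplacianMatrix_apply]
    by_cases h : u = v
    · subst h
      have h1 : ε * (G.degree u / G.μ u) ≤ 1 := by
        refine le_trans ?_ hd
        gcongr
        rw [div_le_iff₀ (G.μ_pos u)]
        exact G.degree_le u
      have h2 : (1 : ℂ) + ((-ε : ℝ) : ℂ) * ((G.degree u / G.μ u : ℝ) : ℂ) =
          ((1 - ε * (G.degree u / G.μ u) : ℝ) : ℂ) := by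
        push_cast
        ring
      simp only [weight_self, Matrix.one_apply_eq, if_true, smul_eq_mul, Complex.ofReal_zero,
        zero_mul, zero_div, sub_zero, mul_zero, add_zero]
      rw [h2, Complex.norm_real, Real.norm_of_nonneg (by linarith)]
    · rw [Matrix.one_apply_ne h, if_neg h, if_neg h, zero_sub, zero_add, zero_add, norm_smul,
        norm_neg, norm_div, norm_mul, norm_mul, Circle.norm_coe, Complex.norm_real,
        Complex.norm_real, Complex.norm_real, Complex.norm_real, norm_neg,
        Real.norm_of_nonneg hε, Real.norm_of_nonneg (G.weight_nonneg u v),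
        Real.norm_of_nonneg hu.le, Real.norm_of_nonneg hv.le]
      refine le_of_eq ?_
      field_simp
  refine (Finset.sum_le_sum fun v _ => hle v).trans (le_of_eq ?_)
  rw [Finset.sum_add_distrib, Finset.sum_ite_eq, if_pos (Finset.mem_univ u), ← Finset.sum_div,
    ← Finset.mul_sum, ← degree_eq]
  have h3 : G.μ u = √(G.μ u) * √(G.μ u) := (Real.mul_self_sqrt (G.μ_pos u).le).symm
  have h4 : ε * (G.degree u / G.μ u) * √(G.μ u) = ε * G.degree u / √(G.μ u) := by
    nth_rewrite 1 [h3]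
    field_simp
  rw [sub_mul, h4]
  ring

/-- The magnetic heat semigroup contracts the weighted `ℓ¹` norm. -/
theorem heatKernel_l1_bound [Nonempty V] (G : MagneticGraph V Γ) {t : ℝ} (ht : 0 ≤ t) (u : V) :
    ∑ v, ‖G.laplacianMatrix_isHermitian.cfc (fun x => Real.exp (-x * t)) u v‖ * √(G.μ v) ≤
      √(G.μ u) := by
  set hH := G.laplacianMatrix_isHermitian
  have hlim : ∀ v, Filter.Tendsto
      (fun k : ℕ => hH.cfc (fun x => (1 + -(t / k) * x) ^ k) u v) Filter.atTop
      (nhds (hH.cfc (fun x => Real.exp (-x * t)) u v)) := fun v => by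
    simp only [Matrix.IsHermitian.cfc_apply]
    refine tendsto_finsetSum _ fun j _ => (Filter.Tendsto.const_mul _ ?_).mul_const _
    refine (Complex.continuous_ofReal.tendsto _).comp ?_
    refine (Real.tendsto_one_add_div_pow_exp (-hH.eigenvalues j * t)).congr fun k => ?_
    congr 2
    ring
  refine le_of_tendsto
    (tendsto_finsetSum _ fun v _ => ((hlim v).norm.mul_const (√(G.μ v)))) ?_
  -- In the Euler approximation `(1 - (t/k) Δ) ^ k`, taking `k ≥ t * d_μ` makes each step of size
  -- `t/k` admissible.
  filter_upwards [Filter.eventually_ge_atTop ⌈t * G.maxDegree⌉₊, Filter.eventually_gt_atTop 0]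
    with k hk hk0
  have hk0' : (0 : ℝ) < k := by exact_mod_cast hk0
  rw [hH.cfc_pow (fun x => 1 + -(t / k) * x), hH.cfc_one_add_mul]
  refine Matrix.sum_norm_pow_mul_le (fun u => G.heat_step_l1_bound (by positivity) ?_ u)
    (fun u => Real.sqrt_nonneg _) k u
  rw [div_mul_eq_mul_div, div_le_one hk0']
  exact Nat.ceil_le.1 hk

end MagneticGraph

/-! ### Decay of the heat kernel diagonal -/

namespace MagneticGraph

variable {V : Type*} {Γ : Subgroup Circle} [Fintype V] [DecidableEq V]

theorem heatKernel_eq_cfc (G : MagneticGraph V Γ) (t : ℝ) :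
    G.heatKernel t = G.laplacianMatrix_isHermitian.cfc fun x => Real.exp (-x * t) :=
  G.laplacianMatrix_isHermitian.exp_smul_eq_cfc t

theorem heatKernel_apply_self (G : MagneticGraph V Γ) (t : ℝ) (u : V) :
    G.heatKernel t u u =
      ((∑ j, ‖(G.laplacianMatrix_isHermitian.eigenvectorUnitary : Matrix V V ℂ) u j‖ ^ 2 *
        Real.exp (-G.eigenvalue j * t) : ℝ) : ℂ) := by
  rw [heatKernel_eq_cfc, Matrix.IsHermitian.cfc_apply_self]
  rfl

theorem trace_heatKernel (G : MagneticGraph V Γ) (t : ℝ) :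
    (G.heatKernel t).trace = ((∑ j, Real.exp (-G.eigenvalue j * t) : ℝ) : ℂ) := by
  rw [heatKernel_eq_cfc, Matrix.IsHermitian.trace_cfc]
  rfl

/-- A row of a unitary matrix is nonzero. Strict positivity permits the negative powers in the
differential inequality. -/
theorem heatKernel_apply_self_pos (G : MagneticGraph V Γ) (t : ℝ) (u : V) :
    0 < (G.heatKernel t u u).re := by
  set W := (G.laplacianMatrix_isHermitian.eigenvectorUnitary : Matrix V V ℂ)
  have hex : ∃ j, W u j ≠ 0 := by
    by_contra! h
    have h1 : (W * star W) u u = 1 := by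
      rw [Unitary.mul_star_self_of_mem (G.laplacianMatrix_isHermitian.eigenvectorUnitary).2,
        Matrix.one_apply_eq]
    rw [Matrix.mul_apply] at h1
    simp [h] at h1
  obtain ⟨j, hj⟩ := hex
  rw [heatKernel_apply_self, Complex.ofReal_re]
  refine Finset.sum_pos' (fun i _ => by positivity) ⟨j, Finset.mem_univ _, ?_⟩
  have := norm_pos_iff.2 hj
  positivity

theorem hasDerivAt_heatKernel_apply_self (G : MagneticGraph V Γ) (t : ℝ) (u : V) :
    HasDerivAt (fun t => (G.heatKernel t u u).re)
      (-∑ j, ‖(G.laplacianMatrix_isHermitian.eigenvectorUnitary : Matrix V V ℂ) u j‖ ^ 2 *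
        (G.eigenvalue j * Real.exp (-G.eigenvalue j * t))) t := by
  simp only [heatKernel_apply_self, Complex.ofReal_re]
  rw [← Finset.sum_neg_distrib]
  refine HasDerivAt.fun_sum fun j _ => ?_
  rw [← mul_neg]
  refine HasDerivAt.const_mul _ ?_
  exact ((hasDerivAt_id' t).const_mul (-G.eigenvalue j)).exp.congr_deriv (by ring)

/-- The differential inequality satisfied by the diagonal of the heat kernel. -/
theorem nash_heatKernel [Nonempty V] (hΓ : IsSignatureGroup Γ) {G : MagneticGraph V Γ}
    {δ c : ℝ} (hδ : 1 < δ) (hG : G.HasIsoperimetricDimension δ c) {t : ℝ} (ht : 0 ≤ t) (u : V) :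
    c ^ 2 * (G.heatKernel t u u).re * ((G.heatKernel t u u).re / (2 * G.μ u)) ^ (2 / δ) ≤
      32 * G.maxDegree *
        ∑ j, ‖(G.laplacianMatrix_isHermitian.eigenvectorUnitary : Matrix V V ℂ) u j‖ ^ 2 *
          (G.eigenvalue j * Real.exp (-G.eigenvalue j * t)) := by
  set hH := G.laplacianMatrix_isHermitian
  -- Half the time: the squared norm of the column at `t/2` is the diagonal entry at `t`.
  set φ : ℝ → ℝ := fun x => Real.exp (-x * (t / 2)) with hφ
  have hφφ : (fun x => φ x * φ x) = fun x => Real.exp (-x * t) := by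
    funext x
    rw [hφ, ← Real.exp_add]
    ring_nf
  set f : V → ℂ := fun v => hH.cfc φ v u with hf
  set g : V → ℂ := fun v => f v / (√(G.μ v) : ℂ) with hg
  have hnorm : ∀ v, ‖g v‖ = ‖f v‖ / √(G.μ v) := fun v => by
    rw [hg, norm_div, Complex.norm_real, Real.norm_of_nonneg (G.sqrt_μ_pos v).le]
  have hN : ∑ v, G.μ v * ‖g v‖ ^ 2 = (G.heatKernel t u u).re := by
    have h := hH.sum_norm_sq_cfc φ u
    rw [hφφ] at h
    rw [heatKernel_eq_cfc, ← h, Complex.ofReal_re]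
    refine Finset.sum_congr rfl fun v _ => ?_
    rw [hnorm, div_pow, Real.sq_sqrt (G.μ_pos v).le, mul_div_cancel₀ _ (G.μ_pos v).ne']
  have hpos := G.heatKernel_apply_self_pos t u
  have hM : ∑ v, G.μ v * ‖g v‖ ≤ √(G.μ u) := by
    refine le_trans (le_of_eq ?_) (G.heatKernel_l1_bound (t := t / 2) (by positivity) u)
    refine Finset.sum_congr rfl fun v _ => ?_
    have h1 : ‖f v‖ = ‖hH.cfc φ u v‖ := by
      rw [hf, ← hH.conjTranspose_cfc φ, Matrix.conjTranspose_apply, norm_star,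
        hH.conjTranspose_cfc]
    rw [hnorm, h1, mul_div_left_comm, Real.div_sqrt]
  have hg0 : g ≠ 0 := by
    intro h
    rw [← hN] at hpos
    simp [h] at hpos
  have hM0 : 0 < ∑ v, G.μ v * ‖g v‖ := by
    obtain ⟨v, hv⟩ := Function.ne_iff.1 hg0
    exact Finset.sum_pos' (fun u _ => mul_nonneg (G.μ_pos u).le (norm_nonneg _))
      ⟨v, Finset.mem_univ _, mul_pos (G.μ_pos _) (norm_pos_iff.2 hv)⟩
  have hE : G.energy g = ∑ j, ‖(hH.eigenvectorUnitary : Matrix V V ℂ) u j‖ ^ 2 *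
      (G.eigenvalue j * Real.exp (-G.eigenvalue j * t)) := by
    have h1 : G.laplacian f = fun v => hH.cfc (fun x => x * φ x) v u := by
      rw [hH.cfc_mul (fun x => x) φ, hH.cfc_self, ← LinearMap.toMatrix'_mulVec]
      rfl
    have h2 : ∑ v, star (f v) * G.laplacian f v = hH.cfc (fun x => φ x * (x * φ x)) u u := by
      rw [hH.cfc_mul φ (fun x => x * φ x), Matrix.mul_apply, h1]
      refine Finset.sum_congr rfl fun v _ => ?_
      rw [hf, ← Matrix.conjTranspose_apply, hH.conjTranspose_cfc]
    rw [hg, ← re_sum_conj_mul_laplacian, h2, hH.cfc_apply_self, Complex.ofReal_re]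
    refine Finset.sum_congr rfl fun j _ => ?_
    rw [mul_left_comm (φ _), show φ (hH.eigenvalues j) * φ (hH.eigenvalues j) = _ from
      congrFun hφφ (hH.eigenvalues j)]
    rfl
  have key := nash hΓ hδ hG hg0
  rw [hN, hE] at key
  refine le_trans ?_ key
  have hc := hG.1
  have hδ0 : 0 < δ := by linarith
  have hM2 : (∑ v, G.μ v * ‖g v‖) ^ 2 ≤ G.μ u := by
    rw [← Real.sq_sqrt (G.μ_pos u).le]
    gcongr
  have hbase : 0 ≤ (G.heatKernel t u u).re / (2 * G.μ u) :=
    div_nonneg hpos.le (mul_nonneg zero_le_two (G.μ_pos u).le)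
  gcongr

/-- On-diagonal heat kernel estimate. -/
theorem heatKernel_apply_self_le [Nonempty V] (hΓ : IsSignatureGroup Γ) {G : MagneticGraph V Γ}
    {δ c : ℝ} (hδ : 1 < δ) (hG : G.HasIsoperimetricDimension δ c) {t : ℝ} (ht : 0 < t) (u : V) :
    (G.heatKernel t u u).re ≤
      2 * (16 * δ * G.maxDegree / c ^ 2) ^ (δ / 2) * G.μ u / t ^ (δ / 2) := by
  have hc := hG.1
  have hδ0 : 0 < δ := by linarith
  have hμ := G.μ_pos u
  have hnash := fun s hs => nash_heatKernel hΓ hδ hG (t := s) hs u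
  set q : ℝ → ℝ := fun s =>
    ∑ j, ‖(G.laplacianMatrix_isHermitian.eigenvectorUnitary : Matrix V V ℂ) u j‖ ^ 2 *
      (G.eigenvalue j * Real.exp (-G.eigenvalue j * s)) with hq
  have hd0 : 0 ≤ G.maxDegree := by
    have h1 := G.degree_le u
    rw [degree_eq] at h1
    have h2 : 0 ≤ G.maxDegree * G.μ u :=
      (Finset.sum_nonneg fun v _ => G.weight_nonneg u v).trans h1
    exact nonneg_of_mul_nonneg_left h2 hμ
  -- If the maximal degree were zero, the Nash inequality at time `0` would bound a positive number
  -- by zero.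
  have hd : 0 < G.maxDegree := by
    refine hd0.lt_of_ne fun h => ?_
    have h1 := hnash 0 le_rfl
    have h2 := G.heatKernel_apply_self_pos 0 u
    have h3 : 0 < c ^ 2 * (G.heatKernel 0 u u).re *
      ((G.heatKernel 0 u u).re / (2 * G.μ u)) ^ (2 / δ) := by positivity
    rw [← h] at h1
    linarith
  set a := c ^ 2 / (32 * G.maxDegree * (2 * G.μ u) ^ (2 / δ)) with ha
  have hX : 0 < (2 * G.μ u) ^ (2 / δ) := by positivity
  have h := le_rpow_of_deriv_le (k := fun s => (G.heatKernel s u u).re) (q := q) (a := a)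
    (p := 2 / δ) (by positivity) (by positivity)
    (fun s => G.hasDerivAt_heatKernel_apply_self s u) (fun s => G.heatKernel_apply_self_pos s u)
    (fun s hs => by
      have h1 := hnash s hs
      have h2 := G.heatKernel_apply_self_pos s u
      rw [Real.div_rpow h2.le (by positivity), mul_div_assoc', div_le_iff₀ hX] at h1
      rw [ha, div_mul_eq_mul_div, div_mul_eq_mul_div, div_le_iff₀ (by positivity)]
      linarith) ht
  refine h.trans (le_of_eq ?_)
  -- Raising this to the power `δ/2` turns `(2 μ(u)) ^ (2/δ)` into `2 μ(u)`, which yields the linear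
  -- dependence on `μ(u)`.
  have h1 : (2 / δ * a * t)⁻¹ = (16 * δ * G.maxDegree / c ^ 2) * (2 * G.μ u) ^ (2 / δ) / t := by
    rw [ha]
    field_simp
    norm_num
  rw [Real.rpow_neg (by positivity), ← Real.inv_rpow (by positivity), h1, inv_div,
    Real.div_rpow (by positivity) ht.le, Real.mul_rpow (by positivity) hX.le,
    ← Real.rpow_mul (by positivity), div_mul_div_cancel₀' (by norm_num), div_self hδ0.ne',
    Real.rpow_one]
  ring

end MagneticGraph

/-! ### Trace and diagonal bounds -/

theorem mainTheorem11 :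
    ∃ C : ℝ → ℝ → ℝ → ℝ,
      ∀ (V : Type*) [Fintype V] [DecidableEq V] [Nonempty V]
        (Γ : Subgroup Circle) (_ : IsSignatureGroup Γ) (G : MagneticGraph V Γ)
        (δ c : ℝ) (_ : 2 < δ) (_ : G.HasIsoperimetricDimension δ c) (t : ℝ) (_ : 0 < t),
        (∑ j, Real.exp (-G.eigenvalue j * t) ≤
          C δ c G.maxDegree * G.vol Finset.univ / t ^ (δ / 2)) ∧
        ∀ u : V, (G.heatKernel t u u).im = 0 ∧
          (G.heatKernel t u u).re ≤ C δ c G.maxDegree * G.μ u / t ^ (δ / 2) := by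
  refine ⟨fun δ c d => 2 * (16 * δ * d / c ^ 2) ^ (δ / 2), ?_⟩
  intro V _ _ _ Γ hΓ G δ c hδ hG t ht
  have hdiag := fun u => MagneticGraph.heatKernel_apply_self_le hΓ (by linarith) hG ht u
  refine ⟨?_, fun u => ⟨?_, hdiag u⟩⟩
  · have htr : ∑ j, Real.exp (-G.eigenvalue j * t) = ∑ u, (G.heatKernel t u u).re := by
      have h := congrArg Complex.re (G.trace_heatKernel t)
      rw [Complex.ofReal_re, Matrix.trace, Complex.re_sum] at h
      exact h.symm
    rw [htr, MagneticGraph.vol, Finset.mul_sum, Finset.sum_div]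
    exact Finset.sum_le_sum fun u _ => hdiag u
  · rw [MagneticGraph.heatKernel_apply_self, Complex.ofReal_im]
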